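/- Let $K$ be a field, $n\ge 0$ and $S=K[x_1,\dots,x_n]$ with its standard grading. Let $F:\ F_0\leftarrow F_1\leftarrow F_2\leftarrow\cdots$ be a minimal graded free resolution of a finitely generated graded $S$-module, with $F_i=\bigoplus_k S(-k)^{\beta_{i,k}}$ finitely generated. Let $E:\ 0\to E^0\to E^1\to\cdots$ be a bounded complex of finitely generated graded free $S$-modules with maps homogeneous of degree zero, and let $\gamma_{j,d}=\dim_K H^j(E)_d$. For integers $c$ and $\tau$ put $$\langle\beta,E\rangle_{c,\tau}=\sum_{\substack{i,j,k\\ j\le i\text{ and }(j<\tau\text{ or }j\le i-2)}}(-1)^{i-j}\beta_{i,k}\,\gamma_{j,-k}\;+\;\sum_{\substack{i,j,k,\epsilon\\ 0\le\epsilon\le1,\ j=\tau,\ i=j+\epsilon,\ k\le c+\epsilon}}(-1)^{i-j}\beta_{i,k}\,\gamma_{j,-k},$$ where $i,j\ge 0$ and $k,\epsilon$ are integers. Then only finitely many terms of these sums are nonzero, and $\langle\beta,E\rangle_{c,\tau}\ge 0$. -/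

import Mathlib

namespace BettiPairing

/-- The data of a finitely generated graded free module `⊕ₛ S(-shift s)` over `S = K[x₁,…,xₙ]`:
its rank and the degrees of its basis elements. -/
structure GradedFree where
  rank : ℕ
  shift : Fin rank → ℤ

/-- The degree `e` part of `S = K[x₁,…,xₙ]`, for an integer `e` (it is zero for `e < 0`). -/
noncomputable def polyPiece (n : ℕ) (K : Type*) [Field K] (e : ℤ) : Submodule K (MvPolynomial (Fin n) K) :=
  MvPolynomial.restrictSupport K {m : Fin n →₀ ℕ | (m.degree : ℤ) = e}

namespace GradedFree

/-- The underlying `S`-module of `⊕ₛ S(-shift s)`. -/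
abbrev Carrier (n : ℕ) (K : Type*) [Field K] (P : GradedFree) : Type _ :=
  Fin P.rank → MvPolynomial (Fin n) K

/-- The degree `d` part of `⊕ₛ S(-shift s)`: since `S(-a)_d = S_{d-a}`, it consists of the vectors
whose `s`-th coordinate is homogeneous of degree `d - shift s`. -/
noncomputable def piece (n : ℕ) (K : Type*) [Field K] (P : GradedFree) (d : ℤ) :
    Submodule K (P.Carrier n K) :=
  Submodule.pi Set.univ fun s => polyPiece n K (d - P.shift s)

end GradedFree

/-- `S`-linear maps of degree zero between graded free modules. -/
structure GradedHom (n : ℕ) (K : Type*) [Field K] (P Q : GradedFree) where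
  toLin : P.Carrier n K →ₗ[MvPolynomial (Fin n) K] Q.Carrier n K
  map_piece : ∀ (d : ℤ) (v : P.Carrier n K), v ∈ P.piece n K d → toLin v ∈ Q.piece n K d

/-- A complex `F₀ ← F₁ ← F₂ ← ⋯` of finitely generated graded free `S`-modules, with maps
homogeneous of degree zero. -/
structure FreeChainComplex (n : ℕ) (K : Type*) [Field K] where
  X : ℕ → GradedFree
  d : ∀ i, GradedHom n K (X (i + 1)) (X i)
  d_comp_d : ∀ i, (d i).toLin ∘ₗ (d (i + 1)).toLin = 0

/-- A complex `0 → E⁰ → E¹ → E² → ⋯` of finitely generated graded free `S`-modules, with maps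
homogeneous of degree zero. -/
structure FreeCochainComplex (n : ℕ) (K : Type*) [Field K] where
  X : ℕ → GradedFree
  d : ∀ j, GradedHom n K (X j) (X (j + 1))
  d_comp_d : ∀ j, (d (j + 1)).toLin ∘ₗ (d j).toLin = 0

namespace FreeChainComplex

variable {n : ℕ} {K : Type*} [Field K]

/-- `F` is a minimal free resolution, namely of the graded `S`-module `coker (F₁ → F₀)`: it is
exact at `F_i` for all `i ≥ 1`, and the image of every differential `F_{i+1} → F_i` lies in
`(x₁,…,xₙ) F_i`. -/
structure IsMinimalFreeResolution (F : FreeChainComplex n K) : Prop where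
  exact : ∀ i, Function.Exact (F.d (i + 1)).toLin (F.d i).toLin
  minimal : ∀ i, LinearMap.range (F.d i).toLin ≤
    Ideal.span (Set.range (MvPolynomial.X : Fin n → MvPolynomial (Fin n) K)) •
      (⊤ : Submodule (MvPolynomial (Fin n) K) ((F.X i).Carrier n K))

/-- The Betti number `β_{i,k}`: the number of summands `S(-k)` of `F_i`. -/
def betti (F : FreeChainComplex n K) (i : ℕ) (k : ℤ) : ℚ :=
  ((Finset.univ.filter fun s : Fin (F.X i).rank => (F.X i).shift s = k).card : ℚ)

end FreeChainComplex

namespace FreeCochainComplex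

variable {n : ℕ} {K : Type*} [Field K]

/-- `E` has only finitely many nonzero terms. -/
def IsBounded (E : FreeCochainComplex n K) : Prop :=
  ∃ N : ℕ, ∀ j, N < j → (E.X j).rank = 0

/-- The kernel of `Eʲ → Eʲ⁺¹`. -/
noncomputable def cocycles (E : FreeCochainComplex n K) (j : ℕ) :
    Submodule (MvPolynomial (Fin n) K) ((E.X j).Carrier n K) :=
  LinearMap.ker (E.d j).toLin

/-- The image of `Eʲ⁻¹ → Eʲ`, where `E⁻¹ = 0`. -/
noncomputable def coboundaries (E : FreeCochainComplex n K) :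
    (j : ℕ) → Submodule (MvPolynomial (Fin n) K) ((E.X j).Carrier n K)
  | 0 => ⊥
  | j + 1 => LinearMap.range (E.d j).toLin

/-- The cohomology module `Hʲ(E)`. -/
abbrev Cohomology (E : FreeCochainComplex n K) (j : ℕ) : Type _ :=
  E.cocycles j ⧸ (E.coboundaries j).comap (E.cocycles j).subtype

/-- The degree `d` part of `Hʲ(E)`: the classes of the cocycles that are homogeneous of
degree `d`. -/
noncomputable def cohomologyPiece (E : FreeCochainComplex n K) (j : ℕ) (d : ℤ) :
    Submodule K (E.Cohomology j) :=
  (((E.X j).piece n K d).comap ((E.cocycles j).subtype.restrictScalars K)).map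
    (((E.coboundaries j).comap (E.cocycles j).subtype).mkQ.restrictScalars K)

/-- The entry `γ_{j,d}` of the cohomology table: the value of the Hilbert function of `Hʲ(E)` in
degree `d`. -/
noncomputable def gamma (E : FreeCochainComplex n K) (j : ℕ) (d : ℤ) : ℚ :=
  (Module.finrank K (E.cohomologyPiece j d) : ℚ)

end FreeCochainComplex

/-- The index set of the modified pairing: the union of the (disjoint) index sets of its two
sums. -/
def modifiedIndexSet (c τ : ℤ) : Set (ℕ × ℕ × ℤ) :=
  {p | match p with
    | (i, j, k) =>
      (j ≤ i ∧ ((j : ℤ) < τ ∨ (j : ℤ) ≤ (i : ℤ) - 2)) ∨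
      (∃ ε : ℕ, ε ≤ 1 ∧ (j : ℤ) = τ ∧ i = j + ε ∧ k ≤ c + ε)}

/-- The term `(-1)^(i-j) β_{i,k} γ_{j,-k}`; it is only used for `j ≤ i`. -/
def pairingTerm (β γ : ℕ → ℤ → ℚ) (p : ℕ × ℕ × ℤ) : ℚ :=
  match p with
  | (i, j, k) => (-1) ^ (i - j) * (β i k * γ j (-k))

/-- The modified bilinear functional `⟨β, γ⟩_{c,τ}`, a sum over all `(i, j, k)` in the index set
for tables `β`, `γ` for which only finitely many of its terms are nonzero. -/
noncomputable def modifiedPairing (c τ : ℤ) (β γ : ℕ → ℤ → ℚ) : ℚ :=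
  ∑ᶠ p ∈ modifiedIndexSet c τ, pairingTerm β γ p

end BettiPairing

/-!
Let `Cᵢ = (Fᵢ ⊗ E)₀`, the complex of vector spaces with terms `⊕ₛ (Eʲ)_{-shift s}`, where `s` runs
over the basis of `Fᵢ` (`FreeCochainComplex.twistSum`). Then
`dim Hʲ(Cᵢ) = ∑ₖ β_{i,k} γ_{j,-k}` (`finrank_homology_twistSum`), and `⋯ → C₂ → C₁ → C₀` is exact
because every `Eʲ` is free (`tensorMap_exact`).

The usual argument compares the two spectral sequences of the double complex `F ⊗ E`. Here this is
replaced by the cokernels `Mᵢ` of `Cᵢ₊₁ → Cᵢ` and the long exact sequences of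
`0 → Mᵢ₊₁ → Cᵢ → Mᵢ → 0`. Let `p i j` and `q i j` be the ranks of `Hʲ(Mᵢ₊₁) → Hʲ(Cᵢ)` and of
`Hʲ(Cᵢ) → Hʲ(Mᵢ)`, and let `r i j` be the dimension of the kernel of `Hʲ(Mᵢ₊₁) → Hʲ(Cᵢ)`. Then
`dim Hʲ(Cᵢ) = p i j + q i j`, and computing `dim Hʲ(Mᵢ₊₁)` in two ways gives
`q (i+1) j + r (i+1) (j+1) = r i j + p i j` (`exists_longExact_ranks`). Summing along diagonals,
`∑ⱼ p (j+m) j = ∑ⱼ q (j+m+1) j`, so that the part `i - j ≥ 2` of the pairing telescopes to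
`∑ⱼ p (j+1) j`. Adding the terms with `j < τ` and `i - j ≤ 1`, everything cancels except for
nonnegative terms, among them `p (τ+1) τ + r τ τ` (`alternating_sum_nonneg`).

What remains are the two truncated terms in row `j = τ`: the dimensions of the `j`-th cohomology of
the subcomplexes `C'_{τ+1} ⊆ C_{τ+1}` and `C'_τ ⊆ C_τ` formed by the summands with shift at most
`c + 1` and at most `c`. As `F` is minimal, `C_{τ+1} → C_τ` maps `C'_{τ+1}` into `C'_τ`
(`exists_twistSumIncl_comp`), and the inclusions split. Hence
`dim Hʲ(C'_{τ+1}) ≤ dim Hʲ(C'_τ) + dim ker (Hʲ(C_{τ+1}) → Hʲ(C_τ))` (`finrank_homology_le`), and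
that kernel has dimension at most `p (τ+1) τ + r τ τ`.

Minimality also makes the pairing finite: the smallest shift of `Fᵢ` grows at least by one with each
step (`exists_lowerBound_shift`), while `(Eʲ)_{-k} = 0` for large `k`.
-/

namespace BettiPairing

open CategoryTheory Limits Module HomologicalComplex

universe u

variable {n : ℕ} {K : Type u} [Field K]

/-! ### Alternating sums along diagonals -/

theorem sum_neg_one_pow_telescope (Q : ℕ → ℚ) (k : ℕ) :
    ∑ m ∈ Finset.range k, (-1 : ℚ) ^ m * (Q m + Q (m + 1)) = Q 0 - (-1) ^ k * Q k := by
  induction k with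
  | zero => simp
  | succ k ih => rw [Finset.sum_range_succ, ih, pow_succ]; ring

/-- With `q (i + 1) j + r (i + 1) (j + 1) = r i j + p i j`, the terms `r` telescope along a
diagonal, as the relation moves their index from `(i, j)` to `(i + 1, j + 1)`. -/
theorem diagonal_sum_eq {p q r : ℕ → ℕ → ℚ}
    (hrel : ∀ i j, q (i + 1) j + r (i + 1) (j + 1) = r i j + p i j)
    (hr0 : ∀ i, r i 0 = 0) (m k : ℕ) :
    ∑ j ∈ Finset.range k, p (j + m) j =
      ∑ j ∈ Finset.range k, q (j + (m + 1)) j + r (k + m) k := by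
  induction k with
  | zero => simp [hr0]
  | succ k ih =>
    have := hrel (k + m) k
    rw [Finset.sum_range_succ, Finset.sum_range_succ, ih,
      show k + 1 + m = k + m + 1 by ring, show k + (m + 1) = k + m + 1 by ring]
    linarith

/-- The numerical core. Here `p + q` are the dimensions on the `E₁` page, and `w m j` is the part of
the entry `(j + m, j)` that is counted: all of it for `m ≥ 2`, and for `m < 2` all of it in rows
`j < τ`, a part of it in row `τ` and nothing beyond. -/
theorem alternating_sum_nonneg {p q r : ℕ → ℕ → ℚ} {I J : ℕ} {τ : ℤ}
    (hp : ∀ i j, 0 ≤ p i j) (hq : ∀ i j, 0 ≤ q i j)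
    (hrel : ∀ i j, q (i + 1) j + r (i + 1) (j + 1) = r i j + p i j)
    (hr0 : ∀ i, r i 0 = 0) (hrJ : ∀ i, r i J = 0)
    (hqI : ∀ i j, I ≤ i → q i j = 0) (hτ : τ < J) (w : ℕ → ℕ → ℚ)
    (hw : ∀ m j, 2 ≤ m → w m j = p (j + m) j + q (j + m) j)
    (hwlt : ∀ m j : ℕ, m < 2 → (j : ℤ) < τ → w m j = p (j + m) j + q (j + m) j)
    (hwgt : ∀ m j : ℕ, m < 2 → τ < (j : ℤ) → w m j = 0)
    (hwτ : ∀ t : ℕ, (t : ℤ) = τ → w 1 t ≤ w 0 t + p (t + 1) t + r t t) :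
    0 ≤ ∑ m ∈ Finset.range (I + 2), ∑ j ∈ Finset.range J, (-1 : ℚ) ^ m * w m j := by
  -- The diagonal sums of `q`; those of `p` are the same up to a shift of `m`.
  let Q : ℕ → ℚ := fun m => ∑ j ∈ Finset.range J, q (j + m) j
  have hPQ : ∀ m, ∑ j ∈ Finset.range J, p (j + m) j = Q (m + 1) := fun m => by
    rw [diagonal_sum_eq hrel hr0 m J, hrJ, add_zero]
  have hQI : Q (I + 2) = 0 := Finset.sum_eq_zero fun j _ => hqI _ _ (by omega)
  have htail : ∑ m ∈ Finset.range I, (-1 : ℚ) ^ (m + 2) *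
      ∑ j ∈ Finset.range J, w (m + 2) j = Q 2 := by
    have h := sum_neg_one_pow_telescope (fun m => Q (m + 2)) I
    simp only [hQI, mul_zero, sub_zero, zero_add] at h
    rw [← h]
    refine Finset.sum_congr rfl fun m _ => ?_
    rw [Finset.sum_congr rfl fun j _ => hw (m + 2) j (by omega), Finset.sum_add_distrib, hPQ,
      pow_add]
    ring
  simp only [← Finset.mul_sum]
  rw [Finset.sum_range_succ', Finset.sum_range_succ', htail]
  simp only [zero_add, pow_one, pow_zero, one_mul, neg_mul]
  rcases lt_or_ge τ 0 with h0 | h0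
  · rw [Finset.sum_eq_zero fun j _ => hwgt 1 j (by omega) (by omega),
      Finset.sum_eq_zero fun j _ => hwgt 0 j (by omega) (by omega)]
    simpa [Q] using Finset.sum_nonneg fun j (_ : j ∈ Finset.range J) => hq (j + 2) j
  · obtain ⟨t, rfl⟩ := Int.eq_ofNat_of_zero_le h0
    have htJ : t + 1 ≤ J := by omega
    have hcut : ∀ m, m < 2 → ∑ j ∈ Finset.range J, w m j =
        ∑ j ∈ Finset.range t, p (j + m) j + ∑ j ∈ Finset.range t, q (j + m) j + w m t := by
      intro m hm
      rw [← Finset.sum_subset (Finset.range_mono htJ) fun j _ hj => hwgt m j hm (by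
        simp only [Finset.mem_range] at hj; omega), Finset.sum_range_succ,
        Finset.sum_congr rfl fun j hj => hwlt m j hm (by
        simp only [Finset.mem_range] at hj; omega), Finset.sum_add_distrib]
    rw [hcut 1 (by omega), hcut 0 (by omega), ← hPQ 1]
    have h1 : ∑ j ∈ Finset.range (t + 1), p (j + 1) j ≤ ∑ j ∈ Finset.range J, p (j + 1) j :=
      Finset.sum_le_sum_of_subset_of_nonneg (Finset.range_mono htJ) fun _ _ _ => hp _ _
    rw [Finset.sum_range_succ] at h1
    have h2 := diagonal_sum_eq hrel hr0 0 t
    have h3 : 0 ≤ ∑ j ∈ Finset.range t, q (j + 0) j := Finset.sum_nonneg fun j _ => hq _ _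
    have h4 := hwτ t rfl
    simp only [add_zero, zero_add] at *
    linarith

/-! ### Ranks in the long exact cohomology sequences of a resolution of complexes -/

theorem finrank_ker_comp_le {V₁ V₂ V₃ : Type*} [AddCommGroup V₁] [AddCommGroup V₂]
    [AddCommGroup V₃] [Module K V₁] [Module K V₂] [Module K V₃] [Module.Finite K V₁]
    [Module.Finite K V₂] (f : V₁ →ₗ[K] V₂) (g : V₂ →ₗ[K] V₃) :
    finrank K (LinearMap.ker (g ∘ₗ f)) ≤
      finrank K (LinearMap.ker f) + finrank K (LinearMap.ker g) := by
  let φ := f.domRestrict (LinearMap.ker (g ∘ₗ f))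
  have h := LinearMap.finrank_range_add_finrank_ker φ
  have h1 : finrank K (LinearMap.range φ) ≤ finrank K (LinearMap.ker g) := by
    refine Submodule.finrank_mono ?_
    rintro _ ⟨x, rfl⟩
    exact x.2
  have h2 : finrank K (LinearMap.ker φ) ≤ finrank K (LinearMap.ker f) := by
    refine LinearMap.finrank_le_finrank_of_injective
      (f := ((LinearMap.ker (g ∘ₗ f)).subtype ∘ₗ (LinearMap.ker φ).subtype).codRestrict
        (LinearMap.ker f) fun x => x.2) ?_
    intro x y hxy
    have h' := congrArg Subtype.val hxy
    exact Subtype.ext (Subtype.ext h')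
  omega

/-- If `u` is injective on cohomology, then the kernel of `Hʲ(g)` embeds into that of `Hʲ(f)`. -/
theorem finrank_homology_le {A₁ A₀ B₁ B₀ : CochainComplex (ModuleCat.{u} K) ℕ} {u : B₁ ⟶ A₁}
    {v : B₀ ⟶ A₀} {f : A₁ ⟶ A₀} {g : B₁ ⟶ B₀} (w : u ≫ f = g ≫ v) (j : ℕ)
    [Mono (homologyMap u j)] [Module.Finite K (A₁.homology j)] [Module.Finite K (B₁.homology j)]
    [Module.Finite K (B₀.homology j)] :
    finrank K (B₁.homology j) ≤
      finrank K (B₀.homology j) + finrank K (LinearMap.ker (homologyMap f j).hom) := by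
  have h := LinearMap.finrank_range_add_finrank_ker (homologyMap g j).hom
  have h1 := Submodule.finrank_le (LinearMap.range (homologyMap g j).hom)
  have h2 : finrank K (LinearMap.ker (homologyMap g j).hom) ≤
      finrank K (LinearMap.ker (homologyMap f j).hom) := by
    have hw : (homologyMap f j).hom ∘ₗ (homologyMap u j).hom =
        (homologyMap v j).hom ∘ₗ (homologyMap g j).hom := by
      rw [← ModuleCat.hom_comp, ← ModuleCat.hom_comp, ← homologyMap_comp, ← homologyMap_comp, w]
    refine LinearMap.finrank_le_finrank_of_injective
      (f := ((homologyMap u j).hom ∘ₗ (LinearMap.ker (homologyMap g j).hom).subtype).codRestrict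
        (LinearMap.ker (homologyMap f j).hom) fun x => ?_) ?_
    · have hx : (homologyMap g j).hom x.1 = 0 := x.2
      have := LinearMap.congr_fun hw x.1
      simp only [LinearMap.comp_apply, hx, map_zero] at this
      exact this
    · intro x y hxy
      exact Subtype.ext ((ModuleCat.mono_iff_injective (homologyMap u j)).1 inferInstance
        (congrArg Subtype.val hxy))
  omega

theorem finite_homology (C : CochainComplex (ModuleCat.{u} K) ℕ) (j : ℕ)
    [Module.Finite K (C.X j)] : Module.Finite K (C.homology j) := by
  have : Module.Finite K (C.cycles j) :=
    Module.Finite.of_injective (C.iCycles j).hom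
      ((ModuleCat.mono_iff_injective _).1 inferInstance)
  exact Module.Finite.of_surjective (C.homologyπ j).hom
    ((ModuleCat.epi_iff_surjective _).1 inferInstance)

theorem isZero_homology_of_isZero (C : CochainComplex (ModuleCat.{u} K) ℕ) (j : ℕ)
    (h : IsZero (C.X j)) : IsZero (C.homology j) :=
  (h.of_mono (C.iCycles j)).of_epi (C.homologyπ j)

theorem mono_homologyMap_zero {A B : CochainComplex (ModuleCat.{u} K) ℕ} (f : A ⟶ B) [Mono f] :
    Mono (homologyMap f 0) := by
  have hA : IsIso (A.homologyπ 0) := A.isIso_homologyπ 0 0 (by simp) (by simp)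
  have hB : IsIso (B.homologyπ 0) := B.isIso_homologyπ 0 0 (by simp) (by simp)
  have h := homologyπ_naturality f 0
  have : homologyMap f 0 = inv (A.homologyπ 0) ≫ cyclesMap f 0 ≫ B.homologyπ 0 := by
    rw [← h, IsIso.inv_hom_id_assoc]
  rw [this]
  infer_instance

/-- An exact sequence `C₂ → C₁ → C₀` yields a short exact sequence
`0 → coker (C₂ → C₁) → C₀ → coker (C₁ → C₀) → 0`. -/
theorem shortExact_cokernel_desc {C₂ C₁ C₀ : CochainComplex (ModuleCat.{u} K) ℕ}
    (g : C₂ ⟶ C₁) (f : C₁ ⟶ C₀) (w : g ≫ f = 0) (h : (ShortComplex.mk g f w).Exact) :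
    (ShortComplex.mk (cokernel.desc g f w) (cokernel.π f)
      (by rw [← cancel_epi (cokernel.π g)]; simp)).ShortExact where
  mono_f := h.mono_cokernelDesc
  epi_g := by dsimp; infer_instance
  exact := by
    let φ : ShortComplex.mk f (cokernel.π f) (by simp) ⟶
        ShortComplex.mk (cokernel.desc g f w) (cokernel.π f)
          (by rw [← cancel_epi (cokernel.π g)]; simp) :=
      { τ₁ := cokernel.π g, τ₂ := 𝟙 _, τ₃ := 𝟙 _ }
    have : Epi φ.τ₁ := by dsimp [φ]; infer_instance
    have : IsIso φ.τ₂ := by dsimp [φ]; infer_instance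
    have : Mono φ.τ₃ := by dsimp [φ]; infer_instance
    exact (ShortComplex.exact_iff_of_epi_of_isIso_of_mono φ).1 (ShortComplex.exact_cokernel f)

theorem finite_cokernel {A B : CochainComplex (ModuleCat.{u} K) ℕ} (f : A ⟶ B) (j : ℕ)
    [Module.Finite K (B.X j)] : Module.Finite K ((cokernel f).X j) :=
  Module.Finite.of_surjective ((cokernel.π f).f j).hom
    ((ModuleCat.epi_iff_surjective _).1 inferInstance)

/-- For an exact sequence `⋯ → C₂ → C₁ → C₀` of complexes with cokernels `Mᵢ = coker (f i)`, the
long exact sequences of `0 → Mᵢ₊₁ → Cᵢ → Mᵢ → 0` are recorded by the numbers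
`p i j = rank (Hʲ(Mᵢ₊₁) → Hʲ(Cᵢ))`, `q i j = rank (Hʲ(Cᵢ) → Hʲ(Mᵢ))` and
`r i j = dim ker (Hʲ(Mᵢ₊₁) → Hʲ(Cᵢ))`; the last is the rank of the connecting map into
`Hʲ(Mᵢ₊₁)`. -/
theorem exists_longExact_ranks (C : ℕ → CochainComplex (ModuleCat.{u} K) ℕ)
    (f : ∀ i, C (i + 1) ⟶ C i) (w : ∀ i, f (i + 1) ≫ f i = 0)
    (hex : ∀ i, (ShortComplex.mk (f (i + 1)) (f i) (w i)).Exact)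
    (hfin : ∀ i j, Module.Finite K ((C i).X j)) {J : ℕ} (hJ : ∀ i, IsZero ((C i).X J)) :
    ∃ p q r : ℕ → ℕ → ℕ,
      (∀ i j, finrank K ((C i).homology j) = p i j + q i j) ∧
      (∀ i j, q (i + 1) j + r (i + 1) (j + 1) = r i j + p i j) ∧
      (∀ i, r i 0 = 0) ∧ (∀ i, r i J = 0) ∧
      (∀ i j, finrank K (LinearMap.ker (homologyMap (f i) j).hom) ≤ p (i + 1) j + r i j) := by
  let M : ℕ → CochainComplex (ModuleCat.{u} K) ℕ := fun i => cokernel (f i)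
  let ι : ∀ i, M (i + 1) ⟶ C i := fun i => cokernel.desc (f (i + 1)) (f i) (w i)
  let π : ∀ i, C i ⟶ M i := fun i => cokernel.π (f i)
  have wS : ∀ i, ι i ≫ π i = 0 := fun i => by
    rw [← cancel_epi (cokernel.π (f (i + 1)))]; simp [ι, π]
  have hS : ∀ i, (ShortComplex.mk (ι i) (π i) (wS i)).ShortExact := fun i =>
    shortExact_cokernel_desc _ _ (w i) (hex i)
  have hι : ∀ i, Mono (ι i) := fun i => (hS i).mono_f
  have finC : ∀ i j, Module.Finite K ((C i).homology j) := fun i j => finite_homology _ j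
  have finM : ∀ i j, Module.Finite K ((M i).homology j) := fun i j => by
    have := finite_cokernel (f i) j
    exact finite_homology (M i) j
  have hH₂ : ∀ i j, LinearMap.range (homologyMap (ι i) j).hom =
      LinearMap.ker (homologyMap (π i) j).hom := fun i j =>
    ((hS i).homology_exact₂ j).moduleCat_range_eq_ker
  refine ⟨fun i j => finrank K (LinearMap.range (homologyMap (ι i) j).hom),
    fun i j => finrank K (LinearMap.range (homologyMap (π i) j).hom),
    fun i j => finrank K (LinearMap.ker (homologyMap (ι i) j).hom), ?_, ?_, ?_, ?_, ?_⟩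
  · intro i j
    beta_reduce
    rw [hH₂, add_comm]
    exact (LinearMap.finrank_range_add_finrank_ker _).symm
  · -- Both sides compute `dim Hʲ(Mᵢ₊₁)`.
    intro i j
    have e₁ := ((hS (i + 1)).homology_exact₁ j (j + 1) (by simp)).moduleCat_range_eq_ker
    have e₃ := ((hS (i + 1)).homology_exact₃ j (j + 1) (by simp)).moduleCat_range_eq_ker
    dsimp at e₁ e₃
    have h1 := LinearMap.finrank_range_add_finrank_ker (homologyMap (ι i) j).hom
    have h2 := LinearMap.finrank_range_add_finrank_ker
      ((hS (i + 1)).δ j (j + 1) (by simp)).hom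
    dsimp at h2
    rw [e₁, ← e₃] at h2
    beta_reduce
    omega
  · intro i
    have := mono_homologyMap_zero (ι i)
    have hker : LinearMap.ker (homologyMap (ι i) 0).hom = ⊥ :=
      LinearMap.ker_eq_bot.2 ((ModuleCat.mono_iff_injective _).1 this)
    beta_reduce
    rw [hker, finrank_bot]
  · intro i
    have hz : IsZero ((M (i + 1)).X J) := (hJ (i + 1)).of_epi ((cokernel.π (f (i + 1))).f J)
    have := ModuleCat.subsingleton_of_isZero (isZero_homology_of_isZero _ J hz)
    exact finrank_zero_of_subsingleton
  · intro i j
    have hcomp : (homologyMap (f i) j).hom =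
        (homologyMap (ι i) j).hom ∘ₗ (homologyMap (π (i + 1)) j).hom := by
      rw [← ModuleCat.hom_comp, ← homologyMap_comp]
      simp [ι, π]
    beta_reduce
    rw [hcomp, hH₂]
    exact finrank_ker_comp_le _ _

/-! ### Homogeneous polynomials and graded free modules -/

theorem mem_polyPiece {e : ℤ} {p : MvPolynomial (Fin n) K} :
    p ∈ polyPiece n K e ↔ ∀ m ∈ p.support, (m.degree : ℤ) = e := Iff.rfl

theorem mul_mem_polyPiece {e f g : ℤ} {p q : MvPolynomial (Fin n) K} (hp : p ∈ polyPiece n K e)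
    (hq : q ∈ polyPiece n K f) (h : e + f = g) : p * q ∈ polyPiece n K g := by
  rw [mem_polyPiece] at *
  intro m hm
  obtain ⟨a, ha, b, hb, rfl⟩ := Finset.mem_add.1 (MvPolynomial.support_mul p q hm)
  rw [map_add]
  push_cast
  rw [hp a ha, hq b hb, h]

theorem one_mem_polyPiece {e : ℤ} (he : e = 0) :
    (1 : MvPolynomial (Fin n) K) ∈ polyPiece n K e := by
  classical
  rw [mem_polyPiece]
  intro m hm
  rw [MvPolynomial.support_one, Finset.mem_singleton] at hm
  simp [hm, he]

theorem polyPiece_eq_bot {e : ℤ} (he : e < 0) : polyPiece n K e = ⊥ := by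
  rw [eq_bot_iff]
  intro p hp
  rw [Submodule.mem_bot, ← MvPolynomial.support_eq_empty, Finset.eq_empty_iff_forall_notMem]
  intro m hm
  have := mem_polyPiece.1 hp m hm
  omega

instance finite_polyPiece (e : ℤ) : Module.Finite K (polyPiece n K e) := by
  have hs : {m : Fin n →₀ ℕ | (m.degree : ℤ) = e}.Finite := by
    refine (Finsupp.finite_of_degree_le e.toNat).subset fun m hm => ?_
    simp only [Set.mem_ofPred_eq] at hm ⊢
    omega
  have := hs.to_subtype
  exact Module.Finite.of_basis (MvPolynomial.basisRestrictSupport K _)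

/-- The homogeneous component of degree `e`, which is zero for `e < 0`. -/
noncomputable def polyProj (n : ℕ) (K : Type*) [Field K] (e : ℤ) :
    MvPolynomial (Fin n) K →ₗ[K] MvPolynomial (Fin n) K :=
  if 0 ≤ e then MvPolynomial.homogeneousComponent e.toNat else 0

theorem coeff_polyProj (e : ℤ) (p : MvPolynomial (Fin n) K) (m : Fin n →₀ ℕ) :
    (polyProj n K e p).coeff m = if (m.degree : ℤ) = e then p.coeff m else 0 := by
  unfold polyProj
  split_ifs with h1 h2 h2
  · rw [MvPolynomial.coeff_homogeneousComponent, if_pos (by omega)]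
  · rw [MvPolynomial.coeff_homogeneousComponent, if_neg (by omega)]
  · omega
  · simp

theorem polyProj_mem (e : ℤ) (p : MvPolynomial (Fin n) K) :
    polyProj n K e p ∈ polyPiece n K e := by
  rw [mem_polyPiece]
  intro m hm
  rw [MvPolynomial.mem_support_iff, coeff_polyProj] at hm
  exact (ite_ne_right_iff.1 hm).1

theorem polyProj_of_mem {e f : ℤ} {p : MvPolynomial (Fin n) K} (hp : p ∈ polyPiece n K f) :
    polyProj n K e p = if f = e then p else 0 := by
  ext m
  rw [coeff_polyProj]
  by_cases hm : m ∈ p.support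
  · rw [mem_polyPiece.1 hp m hm]
    split_ifs <;> simp
  · rw [MvPolynomial.notMem_support_iff] at hm
    split_ifs <;> simp [hm]

/-- A polynomial without constant term that is homogeneous of degree at most `0` vanishes. -/
theorem eq_zero_of_mem_polyPiece {e : ℤ} {p : MvPolynomial (Fin n) K} (hp : p ∈ polyPiece n K e)
    (he : e ≤ 0)
    (hX : p ∈ Ideal.span (Set.range (MvPolynomial.X : Fin n → MvPolynomial (Fin n) K))) :
    p = 0 := by
  rw [← MvPolynomial.support_eq_empty, Finset.eq_empty_iff_forall_notMem]
  intro m hm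
  have h1 := mem_polyPiece.1 hp m hm
  have h2 : m = 0 := (Finsupp.degree_eq_zero_iff m).1 (by omega)
  subst h2
  rw [← Set.image_univ, MvPolynomial.mem_ideal_span_X_image] at hX
  obtain ⟨i, -, hi⟩ := hX 0 hm
  exact hi rfl

namespace GradedFree

variable (P : GradedFree)

theorem mem_piece {d : ℤ} {v : P.Carrier n K} :
    v ∈ P.piece n K d ↔ ∀ s, v s ∈ polyPiece n K (d - P.shift s) := by
  simp [piece, Submodule.mem_pi]

instance finite_piece (d : ℤ) : Module.Finite K (P.piece n K d) := by
  refine Module.Finite.of_injective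
    (LinearMap.pi fun s => ((LinearMap.proj s).comp (P.piece n K d).subtype).codRestrict
      (polyPiece n K (d - P.shift s)) fun v => P.mem_piece.1 v.2 s) ?_
  intro v w h
  ext1
  funext s
  exact congrArg Subtype.val (congrFun h s)

theorem piece_eq_bot {d : ℤ} (h : ∀ s, d < P.shift s) : P.piece n K d = ⊥ := by
  rw [eq_bot_iff]
  intro v hv
  rw [Submodule.mem_bot]
  funext s
  have := P.mem_piece.1 hv s
  rwa [polyPiece_eq_bot (by have := h s; omega), Submodule.mem_bot] at this

theorem single_one_mem_piece (s : Fin P.rank) :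
    (Pi.single s 1 : P.Carrier n K) ∈ P.piece n K (P.shift s) := by
  rw [mem_piece]
  intro t
  rcases eq_or_ne t s with rfl | h
  · rw [Pi.single_eq_same]
    exact one_mem_polyPiece (by omega)
  · rw [Pi.single_eq_of_ne h]
    exact Submodule.zero_mem _

/-- The homogeneous component of degree `d` of a vector. -/
noncomputable def proj (d : ℤ) : P.Carrier n K →ₗ[K] P.Carrier n K :=
  LinearMap.piMap fun s => polyProj n K (d - P.shift s)

theorem proj_apply (d : ℤ) (v : P.Carrier n K) (s : Fin P.rank) :
    P.proj d v s = polyProj n K (d - P.shift s) (v s) := rfl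

theorem proj_mem (d : ℤ) (v : P.Carrier n K) : P.proj d v ∈ P.piece n K d :=
  P.mem_piece.2 fun _ => polyProj_mem _ _

theorem proj_of_mem {d e : ℤ} {v : P.Carrier n K} (hv : v ∈ P.piece n K e) :
    P.proj d v = if e = d then v else 0 := by
  funext s
  rw [proj_apply, polyProj_of_mem (P.mem_piece.1 hv s)]
  simp only [sub_left_inj]
  split_ifs <;> rfl

end GradedFree

namespace GradedHom

variable {P Q : GradedFree} (φ : GradedHom n K P Q)

theorem proj_toLin (d : ℤ) (v : P.Carrier n K) :
    Q.proj d (φ.toLin v) = φ.toLin (P.proj d v) := by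
  -- Both sides are additive, and agree on homogeneous elements of any degree, in particular on
  -- the multiples of basis vectors by monomials.
  suffices h : Q.proj d ∘ₗ φ.toLin.restrictScalars K = φ.toLin.restrictScalars K ∘ₗ P.proj d from
    LinearMap.congr_fun h v
  refine LinearMap.pi_ext' fun s => MvPolynomial.linearMap_ext fun m => LinearMap.ext_ring ?_
  have hv : (Pi.single s (MvPolynomial.monomial m 1) : P.Carrier n K) ∈
      P.piece n K (m.degree + P.shift s) := by
    rw [GradedFree.mem_piece]
    intro t
    rcases eq_or_ne t s with rfl | h
    · rw [Pi.single_eq_same]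
      exact (MvPolynomial.monomial_mem_restrictSupport K).2 (Or.inl (by simp))
    · rw [Pi.single_eq_of_ne h]
      exact Submodule.zero_mem _
  simp only [LinearMap.comp_apply, LinearMap.coe_single, LinearMap.restrictScalars_apply]
  rw [P.proj_of_mem hv, Q.proj_of_mem (φ.map_piece _ _ hv)]
  split_ifs <;> simp

/-- A homogeneous element of the image of `φ` is the image of a homogeneous element. -/
theorem exists_mem_piece_of_mem_range {d : ℤ} {w : Q.Carrier n K} (hw : w ∈ Q.piece n K d)
    (h : w ∈ LinearMap.range φ.toLin) : ∃ v ∈ P.piece n K d, φ.toLin v = w := by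
  obtain ⟨v, rfl⟩ := h
  refine ⟨P.proj d v, P.proj_mem d v, ?_⟩
  rw [← proj_toLin, Q.proj_of_mem hw, if_pos rfl]

/-- The entries of the matrix of `φ`: `φ` maps the `s`-th basis vector to `∑ₜ φₛₜ eₜ`. -/
noncomputable def entry (s : Fin P.rank) (t : Fin Q.rank) : MvPolynomial (Fin n) K :=
  φ.toLin (Pi.single s 1) t

theorem toLin_apply (v : P.Carrier n K) (t : Fin Q.rank) :
    φ.toLin v t = ∑ s, v s * φ.entry s t := by
  conv_lhs => rw [pi_eq_sum_univ' v, map_sum]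
  simp [entry, Finset.sum_apply]

theorem entry_mem (s : Fin P.rank) (t : Fin Q.rank) :
    φ.entry s t ∈ polyPiece n K (P.shift s - Q.shift t) :=
  Q.mem_piece.1 (φ.map_piece _ _ (P.single_one_mem_piece s)) t

/-- The map induced by `φ` on the parts of degree `d`. -/
noncomputable def pieceMap (d : ℤ) : P.piece n K d →ₗ[K] Q.piece n K d :=
  (φ.toLin.restrictScalars K).restrict (φ.map_piece d)

end GradedHom

namespace FreeChainComplex.IsMinimalFreeResolution

variable {F : FreeChainComplex n K} (hF : F.IsMinimalFreeResolution)
include hF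

theorem entry_mem_span (i : ℕ) (s : Fin (F.X (i + 1)).rank) (t : Fin (F.X i).rank) :
    (F.d i).entry s t ∈
      Ideal.span (Set.range (MvPolynomial.X : Fin n → MvPolynomial (Fin n) K)) := by
  have hle : Ideal.span (Set.range (MvPolynomial.X : Fin n → MvPolynomial (Fin n) K)) •
      (⊤ : Submodule (MvPolynomial (Fin n) K) ((F.X i).Carrier n K)) ≤
      Submodule.comap (LinearMap.proj t) (Ideal.span (Set.range MvPolynomial.X)) :=
    Submodule.smul_le.2 fun r hr v _ => Ideal.mul_mem_right (v t) _ hr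
  exact hle (hF.minimal i (LinearMap.mem_range_self (F.d i).toLin (Pi.single s 1)))

theorem entry_eq_zero {i : ℕ} {s : Fin (F.X (i + 1)).rank} {t : Fin (F.X i).rank}
    (h : (F.X (i + 1)).shift s ≤ (F.X i).shift t) : (F.d i).entry s t = 0 :=
  eq_zero_of_mem_polyPiece ((F.d i).entry_mem s t) (by omega) (hF.entry_mem_span i s t)

/-- In a minimal resolution no basis element of `F_{i+1}` is mapped to zero, as the kernel of the
differential lies in `(x₁,…,xₙ) F_{i+1}`. -/
theorem exists_shift_lt (i : ℕ) (s : Fin (F.X (i + 1)).rank) :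
    ∃ t, (F.X i).shift t < (F.X (i + 1)).shift s := by
  by_contra! hcon
  have h0 : (F.d i).toLin (Pi.single s 1) = 0 := funext fun t => hF.entry_eq_zero (hcon t)
  obtain ⟨v, hv⟩ := (hF.exact i _).1 h0
  -- The `s`-th coordinate of the basis vector, namely `1`, would lie in `(x₁,…,xₙ)`.
  have h1 : (1 : MvPolynomial (Fin n) K) ∈
      Ideal.span (Set.range (MvPolynomial.X : Fin n → MvPolynomial (Fin n) K)) := by
    have := congrFun hv s
    rw [Pi.single_eq_same, GradedHom.toLin_apply] at this
    rw [← this]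
    exact Ideal.sum_mem _ fun t _ => Ideal.mul_mem_left _ _ (hF.entry_mem_span (i + 1) t s)
  exact one_ne_zero (eq_zero_of_mem_polyPiece (one_mem_polyPiece rfl) le_rfl h1)

theorem exists_lowerBound_shift :
    ∃ a : ℤ, ∀ i (s : Fin (F.X i).rank), a + i ≤ (F.X i).shift s := by
  obtain ⟨a, ha⟩ := (Set.finite_range (F.X 0).shift).bddBelow
  refine ⟨a, fun i => ?_⟩
  induction i with
  | zero => intro s; simpa using ha ⟨s, rfl⟩
  | succ i ih =>
    intro s
    obtain ⟨t, ht⟩ := hF.exists_shift_lt i s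
    have := ih t
    push_cast
    omega

end FreeChainComplex.IsMinimalFreeResolution

/-! ### The degree zero part of `F ⊗ E` -/

theorem finrank_range_piMap {ι : Type} [Fintype ι] {V W : ι → Type*} [∀ s, AddCommGroup (V s)]
    [∀ s, AddCommGroup (W s)] [∀ s, Module K (V s)] [∀ s, Module K (W s)]
    [∀ s, Module.Finite K (W s)] (f : ∀ s, V s →ₗ[K] W s) :
    finrank K (LinearMap.range (LinearMap.piMap f)) =
      ∑ s, finrank K (LinearMap.range (f s)) := by
  rw [← finrank_pi_fintype]
  let φ : LinearMap.range (LinearMap.piMap f) →ₗ[K] ∀ s, LinearMap.range (f s) :=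
    LinearMap.pi fun s => ((LinearMap.proj s).comp (Submodule.subtype _)).codRestrict
      (LinearMap.range (f s)) (by rintro ⟨_, v, rfl⟩; exact ⟨v s, rfl⟩)
  refine (LinearEquiv.ofBijective φ ⟨?_, ?_⟩).finrank_eq
  · intro v w h
    ext1
    funext s
    exact congrArg Subtype.val (congrFun h s)
  · intro w
    choose v hv using fun s => (w s).2
    exact ⟨⟨LinearMap.piMap f v, v, rfl⟩, funext fun s => Subtype.ext (hv s)⟩

theorem finrank_shortComplex_homology (S : ShortComplex (ModuleCat.{u} K))
    [Module.Finite K S.X₂] :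
    finrank K S.homology + finrank K (LinearMap.range S.f.hom) +
      finrank K (LinearMap.range S.g.hom) = finrank K S.X₂ := by
  have h1 : finrank K S.homology =
      finrank K (LinearMap.ker S.g.hom ⧸ LinearMap.range S.moduleCatToCycles) :=
    S.moduleCatHomologyIso.toLinearEquiv.finrank_eq
  have h2 := Submodule.finrank_quotient_add_finrank (LinearMap.range S.moduleCatToCycles)
  have h3 := LinearMap.finrank_range_add_finrank_ker S.g.hom
  have h4 : finrank K (LinearMap.range S.moduleCatToCycles) =
      finrank K (LinearMap.range S.f.hom) := by
    rw [← Submodule.finrank_map_subtype_eq (LinearMap.ker S.g.hom), ← LinearMap.range_comp]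
    rfl
  omega

theorem finrank_homology_zero (C : CochainComplex (ModuleCat.{u} K) ℕ)
    [Module.Finite K (C.X 0)] :
    finrank K (C.homology 0) + finrank K (LinearMap.range (C.d 0 1).hom) =
      finrank K (C.X 0) := by
  have e : (C.sc 0).homology ≅ (C.sc' 0 0 1).homology :=
    ShortComplex.homologyMapIso (C.isoSc' 0 0 1 (by simp) (by simp))
  have h1 := e.toLinearEquiv.finrank_eq
  have : Module.Finite K (C.sc' 0 0 1).X₂ := ‹_›
  have h := finrank_shortComplex_homology (C.sc' 0 0 1)
  have h0 : (C.sc' 0 0 1).f = 0 := C.shape 0 0 (by simp)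
  rw [← h1, h0, ModuleCat.hom_zero, LinearMap.range_zero, finrank_bot, add_zero] at h
  exact h

theorem finrank_homology_succ (C : CochainComplex (ModuleCat.{u} K) ℕ) (j : ℕ)
    [Module.Finite K (C.X (j + 1))] :
    finrank K (C.homology (j + 1)) + finrank K (LinearMap.range (C.d j (j + 1)).hom) +
      finrank K (LinearMap.range (C.d (j + 1) (j + 2)).hom) = finrank K (C.X (j + 1)) := by
  have e : (C.sc (j + 1)).homology ≅ (C.sc' j (j + 1) (j + 2)).homology :=
    ShortComplex.homologyMapIso (C.isoSc' j (j + 1) (j + 2) (by simp) (by simp))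
  have h1 := e.toLinearEquiv.finrank_eq
  have : Module.Finite K (C.sc' j (j + 1) (j + 2)).X₂ := ‹_›
  have h := finrank_shortComplex_homology (C.sc' j (j + 1) (j + 2))
  rw [← h1] at h
  exact h

namespace FreeCochainComplex

variable (E : FreeCochainComplex n K)

theorem toLin_toLin (j : ℕ) (v : (E.X j).Carrier n K) :
    (E.d (j + 1)).toLin ((E.d j).toLin v) = 0 :=
  LinearMap.congr_fun (E.d_comp_d j) v

/-- The cocycles in `Eʲ` that are homogeneous of degree `d`. -/
noncomputable def pieceCocycles (j : ℕ) (d : ℤ) : Submodule K ((E.X j).Carrier n K) :=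
  (E.X j).piece n K d ⊓ (E.cocycles j).restrictScalars K

theorem finrank_pieceCocycles (j : ℕ) (d : ℤ) :
    finrank K (E.pieceCocycles j d) + finrank K (LinearMap.range ((E.d j).pieceMap d)) =
      finrank K ((E.X j).piece n K d) := by
  have h : (LinearMap.ker ((E.d j).pieceMap d)).map (Submodule.subtype _) =
      E.pieceCocycles j d := by
    ext v
    constructor
    · rintro ⟨x, hx, rfl⟩
      exact ⟨x.2, congrArg Subtype.val hx⟩
    · rintro ⟨h1, h2⟩
      exact ⟨⟨v, h1⟩, Subtype.ext h2, rfl⟩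
  rw [← h, Submodule.finrank_map_subtype_eq, add_comm, LinearMap.finrank_range_add_finrank_ker]

instance finite_pieceCocycles (j : ℕ) (d : ℤ) : Module.Finite K (E.pieceCocycles j d) :=
  Submodule.finiteDimensional_of_le inf_le_left

/-- The map from the homogeneous cocycles of degree `d` to cohomology. -/
noncomputable def pieceCocyclesMap (j : ℕ) (d : ℤ) :
    E.pieceCocycles j d →ₗ[K] E.Cohomology j :=
  (((E.coboundaries j).comap (E.cocycles j).subtype).mkQ.restrictScalars K) ∘ₗ
    (E.pieceCocycles j d).subtype.codRestrict ((E.cocycles j).restrictScalars K) fun x => x.2.2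

theorem range_pieceCocyclesMap (j : ℕ) (d : ℤ) :
    LinearMap.range (E.pieceCocyclesMap j d) = E.cohomologyPiece j d := by
  ext y
  constructor
  · rintro ⟨x, rfl⟩
    exact ⟨⟨x.1, x.2.2⟩, x.2.1, rfl⟩
  · rintro ⟨x, hx, rfl⟩
    exact ⟨⟨x.1, hx, x.2⟩, rfl⟩

theorem mem_ker_pieceCocyclesMap {j : ℕ} {d : ℤ} {x : E.pieceCocycles j d} :
    x ∈ LinearMap.ker (E.pieceCocyclesMap j d) ↔ x.1 ∈ E.coboundaries j :=
  Submodule.Quotient.mk_eq_zero _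

theorem finrank_cohomologyPiece_add (j : ℕ) (d : ℤ) :
    finrank K (E.cohomologyPiece j d) + finrank K (LinearMap.ker (E.pieceCocyclesMap j d)) +
      finrank K (LinearMap.range ((E.d j).pieceMap d)) = finrank K ((E.X j).piece n K d) := by
  have h := LinearMap.finrank_range_add_finrank_ker (E.pieceCocyclesMap j d)
  rw [range_pieceCocyclesMap] at h
  rw [h, finrank_pieceCocycles]

theorem finrank_cohomologyPiece_zero (d : ℤ) :
    finrank K (E.cohomologyPiece 0 d) + finrank K (LinearMap.range ((E.d 0).pieceMap d)) =
      finrank K ((E.X 0).piece n K d) := by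
  have h : LinearMap.ker (E.pieceCocyclesMap 0 d) = ⊥ := by
    rw [eq_bot_iff]
    intro x hx
    exact Subtype.ext (E.mem_ker_pieceCocyclesMap.1 hx)
  have := E.finrank_cohomologyPiece_add 0 d
  rwa [h, finrank_bot, add_zero] at this

theorem finrank_cohomologyPiece_succ (j : ℕ) (d : ℤ) :
    finrank K (E.cohomologyPiece (j + 1) d) +
      finrank K (LinearMap.range ((E.d j).pieceMap d)) +
      finrank K (LinearMap.range ((E.d (j + 1)).pieceMap d)) =
      finrank K ((E.X (j + 1)).piece n K d) := by
  have h : (LinearMap.ker (E.pieceCocyclesMap (j + 1) d)).map (Submodule.subtype _) =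
      (LinearMap.range ((E.d j).pieceMap d)).map (Submodule.subtype _) := by
    ext y
    constructor
    · rintro ⟨x, hx, rfl⟩
      obtain ⟨v, hv, h⟩ := (E.d j).exists_mem_piece_of_mem_range x.2.1
        (E.mem_ker_pieceCocyclesMap.1 hx)
      exact ⟨⟨(E.d j).toLin v, (E.d j).map_piece d v hv⟩, ⟨⟨v, hv⟩, rfl⟩, h⟩
    · rintro ⟨_, ⟨v, rfl⟩, rfl⟩
      exact ⟨⟨((E.d j).pieceMap d v).1, ((E.d j).pieceMap d v).2, E.toLin_toLin j v.1⟩,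
        E.mem_ker_pieceCocyclesMap.2 ⟨v.1, rfl⟩, rfl⟩
  rw [← E.finrank_cohomologyPiece_add (j + 1) d,
    ← Submodule.finrank_map_subtype_eq _ (LinearMap.range ((E.d j).pieceMap d)), ← h,
    Submodule.finrank_map_subtype_eq]

/-- The degree zero part of `(⊕ₛ S(-a s)) ⊗ E`: as `(S(-a) ⊗ Eʲ)₀ = (Eʲ)_{-a}`, its `j`-th term is
`∏ₛ (Eʲ)_{-a s}`. -/
noncomputable def twistSum {ι : Type} (a : ι → ℤ) : CochainComplex (ModuleCat.{u} K) ℕ :=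
  CochainComplex.of (fun j => ModuleCat.of K (∀ s, (E.X j).piece n K (-a s)))
    (fun j => ModuleCat.ofHom (LinearMap.piMap fun s => (E.d j).pieceMap (-a s)))
    fun j => ModuleCat.hom_ext <| LinearMap.ext fun v => funext fun s =>
      Subtype.ext (E.toLin_toLin j (v s).1)

section twistSum

variable {ι κ μ : Type}

theorem twistSum_d (a : ι → ℤ) (j : ℕ) : (E.twistSum a).d j (j + 1) =
    ModuleCat.ofHom (LinearMap.piMap fun s => (E.d j).pieceMap (-a s)) :=
  CochainComplex.of_d _
    (fun j => ModuleCat.ofHom (LinearMap.piMap fun s => (E.d j).pieceMap (-a s))) j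

instance finite_twistSum [Finite ι] (a : ι → ℤ) (j : ℕ) :
    Module.Finite K ((E.twistSum a).X j) :=
  inferInstanceAs (Module.Finite K (∀ s, (E.X j).piece n K (-a s)))

theorem finrank_homology_twistSum [Fintype ι] (a : ι → ℤ) (j : ℕ) :
    (finrank K ((E.twistSum a).homology j) : ℚ) = ∑ s, E.gamma j (-a s) := by
  unfold gamma
  rw [← Nat.cast_sum, Nat.cast_inj]
  have hX : ∀ j, finrank K ((E.twistSum a).X j) = ∑ s, finrank K ((E.X j).piece n K (-a s)) :=
    fun j => finrank_pi_fintype K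
  have hd : ∀ j, finrank K (LinearMap.range ((E.twistSum a).d j (j + 1)).hom) =
      ∑ s, finrank K (LinearMap.range ((E.d j).pieceMap (-a s))) := fun j => by
    rw [twistSum_d]
    exact finrank_range_piMap _
  cases j with
  | zero =>
    have h := finrank_homology_zero (E.twistSum a)
    rw [hX, hd 0, Finset.sum_congr rfl fun s _ => (E.finrank_cohomologyPiece_zero (-a s)).symm,
      Finset.sum_add_distrib] at h
    omega
  | succ j =>
    have h := finrank_homology_succ (E.twistSum a) j
    rw [hX, hd j, hd (j + 1),
      Finset.sum_congr rfl fun s _ => (E.finrank_cohomologyPiece_succ j (-a s)).symm,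
      Finset.sum_add_distrib, Finset.sum_add_distrib] at h
    omega

variable [Fintype ι] {a : ι → ℤ} {b : κ → ℤ} {c : μ → ℤ}

/-- The action of a matrix with homogeneous entries of degrees `a s - b t` on the `j`-th term of
`E.twistSum a`. -/
noncomputable def twistSumMapX (A : ι → κ → MvPolynomial (Fin n) K)
    (hA : ∀ s t, A s t ∈ polyPiece n K (a s - b t)) (j : ℕ) :
    (∀ s, (E.X j).piece n K (-a s)) →ₗ[K] ∀ t, (E.X j).piece n K (-b t) :=
  LinearMap.pi fun t =>
    ((∑ s, ((LinearMap.lsmul (MvPolynomial (Fin n) K) ((E.X j).Carrier n K)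
      (A s t)).restrictScalars K) ∘ₗ ((E.X j).piece n K (-a s)).subtype ∘ₗ
        LinearMap.proj s)).codRestrict ((E.X j).piece n K (-b t)) fun v => by
      rw [LinearMap.sum_apply]
      refine Submodule.sum_mem _ fun s _ => (GradedFree.mem_piece _).2 fun x => ?_
      exact mul_mem_polyPiece (hA s t) ((GradedFree.mem_piece _).1 (v s).2 x) (by ring)

theorem twistSumMapX_apply (A : ι → κ → MvPolynomial (Fin n) K)
    (hA : ∀ s t, A s t ∈ polyPiece n K (a s - b t)) (j : ℕ)
    (v : ∀ s, (E.X j).piece n K (-a s)) (t : κ) :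
    (E.twistSumMapX A hA j v t).1 = ∑ s, A s t • (v s).1 := by
  simp [twistSumMapX]

/-- The map `⊕ₛ S(-a s) → ⊕ₜ S(-b t)` given by a matrix with homogeneous entries of degrees
`a s - b t`, tensored with `E`, in degree zero. -/
noncomputable def twistSumMap (A : ι → κ → MvPolynomial (Fin n) K)
    (hA : ∀ s t, A s t ∈ polyPiece n K (a s - b t)) : E.twistSum a ⟶ E.twistSum b :=
  CochainComplex.ofHom (fun j => ModuleCat.ofHom (E.twistSumMapX A hA j)) fun j => by
    rw [twistSum_d, twistSum_d]
    refine ModuleCat.hom_ext <| LinearMap.ext fun (v : ∀ s, (E.X j).piece n K (-a s)) =>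
      funext fun t => Subtype.ext ?_
    change (E.d j).toLin (E.twistSumMapX A hA j v t).1 = (E.twistSumMapX A hA (j + 1)
      (LinearMap.piMap (fun s => (E.d j).pieceMap (-a s)) v) t).1
    rw [twistSumMapX_apply, twistSumMapX_apply, map_sum]
    simp only [map_smul]
    rfl

theorem twistSumMap_comp [Fintype κ] (A : ι → κ → MvPolynomial (Fin n) K)
    (hA : ∀ s t, A s t ∈ polyPiece n K (a s - b t)) (B : κ → μ → MvPolynomial (Fin n) K)
    (hB : ∀ s t, B s t ∈ polyPiece n K (b s - c t)) (D : ι → μ → MvPolynomial (Fin n) K)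
    (hD : ∀ s t, D s t ∈ polyPiece n K (a s - c t)) (h : ∀ s u, ∑ t, A s t * B t u = D s u) :
    E.twistSumMap A hA ≫ E.twistSumMap B hB = E.twistSumMap D hD := by
  refine HomologicalComplex.hom_ext _ _ fun j => ModuleCat.hom_ext <| LinearMap.ext
    fun (v : ∀ s, (E.X j).piece n K (-a s)) => funext fun t => Subtype.ext ?_
  change (E.twistSumMapX B hB j (E.twistSumMapX A hA j v) t).1 = (E.twistSumMapX D hD j v t).1
  simp only [twistSumMapX_apply, Finset.smul_sum, ← h, Finset.sum_smul, smul_smul]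
  rw [Finset.sum_comm]
  simp only [mul_comm]

theorem twistSumMap_eq_zero (A : ι → κ → MvPolynomial (Fin n) K)
    (hA : ∀ s t, A s t ∈ polyPiece n K (a s - b t)) (h : ∀ s t, A s t = 0) :
    E.twistSumMap A hA = 0 := by
  refine HomologicalComplex.hom_ext _ _ fun j => ModuleCat.hom_ext <| LinearMap.ext
    fun (v : ∀ s, (E.X j).piece n K (-a s)) => funext fun t => Subtype.ext ?_
  change (E.twistSumMapX A hA j v t).1 = 0
  simp [twistSumMapX_apply, h]

theorem twistSumMap_eq_id [DecidableEq ι] (A : ι → ι → MvPolynomial (Fin n) K)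
    (hA : ∀ s t, A s t ∈ polyPiece n K (a s - a t)) (h : ∀ s t, A s t = if s = t then 1 else 0) :
    E.twistSumMap A hA = 𝟙 _ := by
  refine HomologicalComplex.hom_ext _ _ fun j => ModuleCat.hom_ext <| LinearMap.ext
    fun (v : ∀ s, (E.X j).piece n K (-a s)) => funext fun t => Subtype.ext ?_
  change (E.twistSumMapX A hA j v t).1 = (v t).1
  simp [twistSumMapX_apply, h]

/-- The inclusion of the summands with `a s ≤ e`. -/
noncomputable def twistSumIncl [DecidableEq ι] (a : ι → ℤ) (e : ℤ) :
    E.twistSum (fun s : {s // a s ≤ e} => a s) ⟶ E.twistSum a :=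
  E.twistSumMap (fun s t => if s.1 = t then 1 else 0) fun s t => by
    split_ifs with h
    · exact one_mem_polyPiece (by rw [h, sub_self])
    · exact Submodule.zero_mem _

instance mono_homologyMap_twistSumIncl [DecidableEq ι] (a : ι → ℤ) (e : ℤ) (j : ℕ) :
    Mono (homologyMap (E.twistSumIncl a e) j) := by
  let ρ : E.twistSum a ⟶ E.twistSum (fun s : {s // a s ≤ e} => a s) :=
    E.twistSumMap (fun s t => if s = t.1 then 1 else 0) fun s t => by
      split_ifs with h
      · exact one_mem_polyPiece (by rw [h, sub_self])
      · exact Submodule.zero_mem _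
  have h : E.twistSumIncl a e ≫ ρ = 𝟙 _ := by
    rw [← E.twistSumMap_eq_id (fun s t => if s = t then 1 else 0) (fun s t => by
      split_ifs with h
      · exact one_mem_polyPiece (by rw [h, sub_self])
      · exact Submodule.zero_mem _) fun _ _ => rfl]
    refine E.twistSumMap_comp _ _ _ _ _ _ fun s u => ?_
    simp [Subtype.ext_iff]
  have h' : homologyMap (E.twistSumIncl a e) j ≫ homologyMap ρ j = 𝟙 _ := by
    rw [← homologyMap_comp, h, homologyMap_id]
  exact mono_of_mono_fac h'

/-- A matrix all of whose nonzero entries from `a s ≤ e` go to `b t ≤ e'` restricts to the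
corresponding summands. -/
theorem exists_twistSumIncl_comp [Fintype κ] [DecidableEq ι] [DecidableEq κ]
    (A : ι → κ → MvPolynomial (Fin n) K)
    (hA : ∀ s t, A s t ∈ polyPiece n K (a s - b t)) {e e' : ℤ}
    (h : ∀ s t, a s ≤ e → e' < b t → A s t = 0) :
    ∃ g, E.twistSumIncl a e ≫ E.twistSumMap A hA = g ≫ E.twistSumIncl b e' := by
  refine ⟨E.twistSumMap (fun s t => A s.1 t.1) fun s t => hA s.1 t.1, ?_⟩
  have h1 : E.twistSumIncl a e ≫ E.twistSumMap A hA =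
      E.twistSumMap (fun s : {s // a s ≤ e} => A s.1) fun s t => hA s.1 t :=
    E.twistSumMap_comp _ _ _ _ _ _ fun s u => by simp
  rw [h1]
  refine (E.twistSumMap_comp _ _ _ _ _ _ fun s u => ?_).symm
  by_cases hu : b u ≤ e'
  · rw [Finset.sum_eq_single ⟨u, hu⟩ (fun t _ ht => by
      rw [if_neg fun h => ht (Subtype.ext h), mul_zero]) (by simp), if_pos rfl, mul_one]
  · rw [h s.1 u s.2 (not_le.1 hu)]
    exact Finset.sum_eq_zero fun t _ => by
      rw [if_neg fun htu : t.1 = u => hu (htu ▸ t.2), mul_zero]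

end twistSum

/-- The map on `(- ⊗ E)₀` induced by a homogeneous map of graded free modules. -/
noncomputable def tensorMap {P Q : GradedFree} (φ : GradedHom n K P Q) :
    E.twistSum P.shift ⟶ E.twistSum Q.shift :=
  E.twistSumMap φ.entry φ.entry_mem

theorem tensorMap_comp_eq_zero {P Q R : GradedFree} (φ : GradedHom n K P Q)
    (ψ : GradedHom n K Q R) (h : ψ.toLin ∘ₗ φ.toLin = 0) :
    E.tensorMap φ ≫ E.tensorMap ψ = 0 := by
  have hφψ : ∀ s u, ∑ t, φ.entry s t * ψ.entry t u = 0 := fun s u => by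
    exact (ψ.toLin_apply (φ.toLin (Pi.single s 1)) u).symm.trans
      (congrFun (LinearMap.congr_fun h _) u)
  rw [tensorMap, tensorMap, E.twistSumMap_comp _ _ _ _ (fun _ _ => 0)
    (fun _ _ => Submodule.zero_mem _) hφψ]
  exact E.twistSumMap_eq_zero _ _ fun _ _ => rfl

/-- Tensoring with the free modules `Eʲ` preserves exactness: for each basis element of `Eʲ`, the
corresponding coordinates form a copy of the given sequence, twisted. -/
theorem tensorMap_exact {P Q R : GradedFree} (φ : GradedHom n K P Q)
    (ψ : GradedHom n K Q R) (h : Function.Exact φ.toLin ψ.toLin)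
    (w : E.tensorMap φ ≫ E.tensorMap ψ = 0) :
    (ShortComplex.mk (E.tensorMap φ) (E.tensorMap ψ) w).Exact := by
  refine HomologicalComplex.exact_of_degreewise_exact _ fun j => ?_
  rw [ShortComplex.moduleCat_exact_iff]
  intro (v : ∀ s, (E.X j).piece n K (-Q.shift s)) hv
  have hv' : ∀ t, ∑ s, ψ.entry s t • (v s).1 = 0 := fun t => by
    rw [← E.twistSumMapX_apply ψ.entry ψ.entry_mem]
    exact congrArg Subtype.val (congrFun hv t)
  have hcol : ∀ x : Fin (E.X j).rank, ∃ y ∈ P.piece n K (-(E.X j).shift x),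
      φ.toLin y = fun s => (v s).1 x := fun x => by
    refine φ.exists_mem_piece_of_mem_range (Q.mem_piece.2 fun s => ?_) ((h _).1 ?_)
    · have := (E.X j).mem_piece.1 (v s).2 x
      rwa [show -(E.X j).shift x - Q.shift s = -Q.shift s - (E.X j).shift x by ring]
    · funext t
      rw [ψ.toLin_apply]
      simpa [mul_comm, Finset.sum_apply] using congrFun (hv' t) x
  choose y hy hyφ using hcol
  refine ⟨(fun s => ⟨fun x => y x s, (E.X j).mem_piece.2 fun x => ?_⟩ :
    ∀ s, (E.X j).piece n K (-P.shift s)), ?_⟩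
  · have := P.mem_piece.1 (hy x) s
    rwa [show -P.shift s - (E.X j).shift x = -(E.X j).shift x - P.shift s by ring]
  · funext t
    refine Subtype.ext ?_
    refine (E.twistSumMapX_apply φ.entry φ.entry_mem j _ t).trans ?_
    funext x
    have := congrFun (hyφ x) t
    rw [φ.toLin_apply] at this
    simpa [mul_comm, Finset.sum_apply] using this

end FreeCochainComplex

/-! ### The modified pairing -/

namespace FreeCochainComplex

variable (E : FreeCochainComplex n K)

theorem gamma_eq_zero {j : ℕ} {d : ℤ} (h : ∀ s, d < (E.X j).shift s) : E.gamma j d = 0 := by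
  have h1 := E.finrank_cohomologyPiece_add j d
  have h2 : finrank K ((E.X j).piece n K d) = 0 := by rw [(E.X j).piece_eq_bot h, finrank_bot]
  rw [gamma, Nat.cast_eq_zero]
  omega

variable {E} in
theorem IsBounded.exists_lowerBound_shift (hE : E.IsBounded) :
    ∃ b : ℤ, ∀ j (s : Fin (E.X j).rank), b ≤ (E.X j).shift s := by
  obtain ⟨N, hN⟩ := hE
  have hfin : (⋃ j ∈ Set.Iic N, Set.range (E.X j).shift).Finite :=
    (Set.finite_Iic N).biUnion fun j _ => Set.finite_range _
  obtain ⟨b, hb⟩ := hfin.bddBelow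
  refine ⟨b, fun j s => hb ?_⟩
  have hj : j ≤ N := by
    by_contra! hj
    exact (Fin.cast (hN j hj) s).elim0
  exact Set.mem_biUnion hj ⟨s, rfl⟩

end FreeCochainComplex

/-- A sum weighted by Betti numbers is a sum over basis elements; `T` need only contain the shifts
at which `g` does not vanish. -/
theorem FreeChainComplex.sum_betti_mul (F : FreeChainComplex n K) (i : ℕ) (g : ℤ → ℚ)
    (T : Finset ℤ) (hT : ∀ s, (F.X i).shift s ∉ T → g ((F.X i).shift s) = 0) :
    ∑ k ∈ T, F.betti i k * g k = ∑ s, g ((F.X i).shift s) := by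
  have h : ∀ k, F.betti i k * g k = ∑ s, if (F.X i).shift s = k then g k else 0 := fun k => by
    rw [betti, ← Finset.sum_boole, Finset.sum_mul]
    simp
  rw [Finset.sum_congr rfl fun k _ => h k, Finset.sum_comm]
  refine Finset.sum_congr rfl fun s _ => ?_
  rw [Finset.sum_ite_eq]
  split_ifs with hs
  · rfl
  · exact (hT s hs).symm

theorem FreeChainComplex.exists_shift_eq_of_betti_ne_zero {F : FreeChainComplex n K} {i : ℕ}
    {k : ℤ} (h : F.betti i k ≠ 0) : ∃ s, (F.X i).shift s = k := by
  obtain ⟨s, hs⟩ := Finset.card_ne_zero.1 (Nat.cast_ne_zero.1 h)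
  exact ⟨s, (Finset.mem_filter.1 hs).2⟩

/-- The indices `(j + m, j, k)` of the terms on the `m`-th diagonal that enter the pairing. -/
theorem mem_modifiedIndexSet {c τ : ℤ} {m j : ℕ} {k : ℤ} :
    (j + m, j, k) ∈ modifiedIndexSet c τ ↔
      2 ≤ m ∨ m < 2 ∧ ((j : ℤ) < τ ∨ (j : ℤ) = τ ∧ k ≤ c + m) := by
  change (j ≤ j + m ∧ ((j : ℤ) < τ ∨ (j : ℤ) ≤ ((j + m : ℕ) : ℤ) - 2)) ∨
    (∃ ε : ℕ, ε ≤ 1 ∧ (j : ℤ) = τ ∧ j + m = j + ε ∧ k ≤ c + ε) ↔ _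
  constructor
  · rintro (h | ⟨ε, h1, h2, h3, h4⟩)
    · omega
    · obtain rfl : m = ε := by omega
      omega
  · rintro (h | ⟨h1, h2 | h2⟩)
    · left; omega
    · left; omega
    · right; exact ⟨m, by omega, h2.1, rfl, h2.2⟩

theorem exists_eq_add_of_mem_modifiedIndexSet {c τ : ℤ} {i j : ℕ} {k : ℤ}
    (h : (i, j, k) ∈ modifiedIndexSet c τ) : ∃ m, i = j + m := by
  rcases h with h | ⟨ε, -, -, h, -⟩
  · exact ⟨i - j, by omega⟩
  · exact ⟨ε, h⟩

theorem pairingTerm_add (β γ : ℕ → ℤ → ℚ) (m j : ℕ) (k : ℤ) :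
    pairingTerm β γ (j + m, j, k) = (-1) ^ m * (β (j + m) k * γ j (-k)) := by
  simp [pairingTerm]

/-- If the terms of the pairing live on finitely many indices `(j + m, j, k)`, the pairing is a
finite sum along the diagonals `m = i - j`. -/
theorem modifiedPairing_eq_sum (c τ : ℤ) (β γ : ℕ → ℤ → ℚ) (I J : ℕ) (T : Finset ℤ)
    (hsupp : ∀ m j k, β (j + m) k * γ j (-k) ≠ 0 → m < I ∧ j < J ∧ k ∈ T) :
    (modifiedIndexSet c τ ∩ Function.support (pairingTerm β γ)).Finite ∧
    modifiedPairing c τ β γ = ∑ m ∈ Finset.range I, ∑ j ∈ Finset.range J, (-1 : ℚ) ^ m *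
      ∑ k ∈ T, β (j + m) k * (if 2 ≤ m ∨ m < 2 ∧ ((j : ℤ) < τ ∨ (j : ℤ) = τ ∧ k ≤ c + m) then
        γ j (-k) else 0) := by
  classical
  let φ : ℕ × ℕ × ℤ → ℕ × ℕ × ℤ := fun p => (p.2.1 + p.1, p.2.1, p.2.2)
  have hφ : Function.Injective φ := by
    rintro ⟨m, j, k⟩ ⟨m', j', k'⟩ h
    simp only [φ, Prod.mk.injEq] at h ⊢
    omega
  let U := (Finset.range I ×ˢ Finset.range J ×ˢ T).image φ
  have hU : modifiedIndexSet c τ ∩ Function.support (pairingTerm β γ) ⊆ U := by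
    rintro ⟨i, j, k⟩ ⟨h1, h2⟩
    obtain ⟨m, rfl⟩ := exists_eq_add_of_mem_modifiedIndexSet h1
    rw [Function.mem_support, pairingTerm_add] at h2
    obtain ⟨hm, hj, hk⟩ := hsupp m j k (right_ne_zero_of_mul h2)
    exact Finset.mem_coe.2 (Finset.mem_image.2 ⟨(m, j, k), by simp [hm, hj, hk], rfl⟩)
  refine ⟨U.finite_toSet.subset hU, ?_⟩
  rw [modifiedPairing, finsum_mem_def,
    finsum_eq_sum_of_support_subset (s := U) _ (by rwa [Set.support_indicator]),
    Finset.sum_image fun _ _ _ _ h => hφ h, Finset.sum_product]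
  refine Finset.sum_congr rfl fun m _ => ?_
  rw [Finset.sum_product]
  refine Finset.sum_congr rfl fun j _ => ?_
  rw [Finset.mul_sum]
  refine Finset.sum_congr rfl fun k _ => ?_
  simp only [φ]
  rw [Set.indicator_apply]
  simp only [mem_modifiedIndexSet, pairingTerm_add]
  split_ifs <;> simp

/-- The pairing is a sum over the diagonals `m = i - j`, to which `alternating_sum_nonneg` applies with
the ranks in the long exact sequences of the complexes `(Fᵢ ⊗ E)₀`. -/
theorem finite_and_modifiedPairing_nonneg (F : FreeChainComplex n K) (hF : F.IsMinimalFreeResolution)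
    (E : FreeCochainComplex n K) (hE : E.IsBounded) (c τ : ℤ) :
    (modifiedIndexSet c τ ∩
      Function.support (pairingTerm F.betti E.gamma)).Finite ∧
    0 ≤ modifiedPairing c τ F.betti E.gamma := by
  obtain ⟨a, ha⟩ := hF.exists_lowerBound_shift
  obtain ⟨b, hb⟩ := hE.exists_lowerBound_shift
  obtain ⟨N, hN⟩ := hE
  -- `β_{i,k} ≠ 0` forces `a + i ≤ k` and `γ_{j,-k} ≠ 0` forces `k ≤ -b`, so both are nonzero only
  -- for `i < I`; `J` bounds the length of `E` and also exceeds `τ`.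
  set I : ℕ := (-b - a + 1).toNat with hI
  set J : ℕ := max (N + 1) (τ.toNat + 1) with hJ
  have hγ : ∀ j k, -b < k → E.gamma j (-k) = 0 := fun j k hk =>
    E.gamma_eq_zero fun s => by have := hb j s; omega
  have hγJ : ∀ j k, J ≤ j → E.gamma j k = 0 := fun j k hj =>
    E.gamma_eq_zero fun s => (Fin.cast (hN j (by omega)) s).elim0
  have hT : ∀ i (s : Fin (F.X i).rank), (F.X i).shift s ∉ Finset.Icc a (-b) →
      ∀ j, E.gamma j (-(F.X i).shift s) = 0 := fun i s hs j => hγ _ _ (by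
    rw [Finset.mem_Icc] at hs
    have := ha i s
    omega)
  obtain ⟨hfin, hsum⟩ := modifiedPairing_eq_sum c τ F.betti E.gamma (I + 2) J
    (Finset.Icc a (-b)) fun m j k h => by
      obtain ⟨s, rfl⟩ := F.exists_shift_eq_of_betti_ne_zero (left_ne_zero_of_mul h)
      have h1 := ha _ s
      have h2 : (F.X (j + m)).shift s ≤ -b := by
        by_contra! hk
        exact right_ne_zero_of_mul h (hγ _ _ hk)
      have h3 : j < J := by
        by_contra! hj
        exact right_ne_zero_of_mul h (hγJ _ _ hj)
      rw [Finset.mem_Icc]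
      push_cast at h1
      omega
  refine ⟨hfin, ?_⟩
  rw [hsum]
  obtain ⟨p, q, r, hh, hrel, hr0, hrJ, hker⟩ := exists_longExact_ranks
    (fun i => E.twistSum (F.X i).shift) (fun i => E.tensorMap (F.d i))
    (fun i => E.tensorMap_comp_eq_zero _ _ (F.d_comp_d i))
    (fun i => E.tensorMap_exact _ _ (hF.exact i) _) (fun i j => inferInstance) (J := J) fun i => by
      have : Subsingleton ((E.twistSum (F.X i).shift).X J) := by
        have : IsEmpty (Fin (E.X J).rank) := by
          rw [hN J (by omega)]; infer_instance
        change Subsingleton (∀ s, (E.X J).piece n K (-(F.X i).shift s))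
        infer_instance
      exact ModuleCat.isZero_of_subsingleton _
  have hpq : ∀ i j, ∑ s, E.gamma j (-(F.X i).shift s) = (p i j : ℚ) + q i j := fun i j => by
    rw [← E.finrank_homology_twistSum, hh]
    push_cast
    rfl
  refine alternating_sum_nonneg (p := fun i j => p i j) (q := fun i j => q i j)
    (r := fun i j => r i j) (τ := τ) (fun _ _ => Nat.cast_nonneg _) (fun _ _ => Nat.cast_nonneg _)
    (fun i j => by exact_mod_cast hrel i j) (fun i => by exact_mod_cast hr0 i)
    (fun i => by exact_mod_cast hrJ i) (fun i j hi => ?_) (by omega) _ (fun m j hm => ?_)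
    (fun m j hm hj => ?_) (fun m j hm hj => ?_) (fun t ht => ?_)
  · have h0 : ∑ s, E.gamma j (-(F.X i).shift s) = 0 := Finset.sum_eq_zero fun s _ =>
      hγ _ _ (by have := ha i s; omega)
    rw [hpq] at h0
    have h0' : p i j + q i j = 0 := by exact_mod_cast h0
    exact_mod_cast (Nat.add_eq_zero_iff.1 h0').2
  · simp only [hm, true_or, if_true]
    rw [F.sum_betti_mul _ (fun k => E.gamma j (-k)) _ fun s hs => hT _ s hs j, hpq]
  · simp only [hm, hj, true_and, true_or, or_true, if_true]
    rw [F.sum_betti_mul _ (fun k => E.gamma j (-k)) _ fun s hs => hT _ s hs j, hpq]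
  · refine Finset.sum_eq_zero fun k _ => ?_
    rw [if_neg (by omega), mul_zero]
  · -- On the diagonals `m = 0, 1` and in row `τ`, only the summands of `F_{τ+m}` with shift at most
    -- `c + m` contribute.
    have hpart : ∀ m : ℕ, m < 2 → ∑ k ∈ Finset.Icc a (-b), F.betti (t + m) k *
        (if 2 ≤ m ∨ m < 2 ∧ ((t : ℤ) < τ ∨ (t : ℤ) = τ ∧ k ≤ c + m) then
          E.gamma t (-k) else 0) =
        (Module.finrank K ((E.twistSum fun s : {s // (F.X (t + m)).shift s ≤ c + m} =>
          (F.X (t + m)).shift s).homology t) : ℚ) := by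
      intro m hm
      rw [F.sum_betti_mul _ (fun k => if 2 ≤ m ∨ m < 2 ∧ ((t : ℤ) < τ ∨ (t : ℤ) = τ ∧ k ≤ c + m)
        then E.gamma t (-k) else 0) _ fun s hs => by rw [hT _ s hs t, ite_self],
        E.finrank_homology_twistSum]
      have hcond : ∀ s, (2 ≤ m ∨ m < 2 ∧ ((t : ℤ) < τ ∨ (t : ℤ) = τ ∧
          (F.X (t + m)).shift s ≤ c + m)) ↔ (F.X (t + m)).shift s ≤ c + m := fun s => by omega
      simp only [hcond]
      rw [← Finset.sum_filter]
      exact Finset.sum_subtype _ (fun s => by simp) _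
    rw [hpart 1 (by omega), hpart 0 (by omega)]
    -- By minimality the differential lowers shifts, so these summands are mapped to each other.
    obtain ⟨g, hg⟩ := E.exists_twistSumIncl_comp (F.d t).entry (F.d t).entry_mem
      (e := c + (1 : ℕ)) (e' := c + (0 : ℕ)) fun s x h1 h2 => hF.entry_eq_zero (by
        push_cast at h1 h2; omega)
    have hfd : ∀ {ι : Type} [Finite ι] (a : ι → ℤ),
        Module.Finite K ((E.twistSum a).homology t) := fun a => finite_homology _ t
    have h := (finrank_homology_le hg t).trans
      ((Nat.add_le_add_left (hker t t) _).trans_eq (add_assoc _ _ _).symm)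
    rw [← Nat.cast_le (α := ℚ), Nat.cast_add, Nat.cast_add] at h
    exact h

end BettiPairing

theorem mainTheorem8 {K : Type*} [Field K] (n : ℕ)
    (F : BettiPairing.FreeChainComplex n K) (hF : F.IsMinimalFreeResolution)
    (E : BettiPairing.FreeCochainComplex n K) (hE : E.IsBounded) (c τ : ℤ) :
    (BettiPairing.modifiedIndexSet c τ ∩
      Function.support (BettiPairing.pairingTerm F.betti E.gamma)).Finite ∧
    0 ≤ BettiPairing.modifiedPairing c τ F.betti E.gamma :=
  BettiPairing.finite_and_modifiedPairing_nonneg F hF E hE c τ
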